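/- Theorem 1.2. For a finite field $\mathbb{F}_q$ with $q$ elements, an integer $d\ge 3$ and $r\in\mathbb{F}_q$ put $$P_d=\{x\in\mathbb{F}_q^d:\ x_d=x_1^2+\dots+x_{d-1}^2\},\qquad S_r=\{x\in\mathbb{F}_q^{d-1}:\ x_1^2+\dots+x_{d-1}^2=r\},$$ and for $E\subset\mathbb{F}_q^d$ let $\Pi(E)=\{x\cdot y:\ x,y\in E\}$, where $x\cdot y=\sum_i x_iy_i$. For a nontrivial additive character $\chi:\mathbb{F}_q\to\mathbb{C}^*$ and $f:S_r\to\mathbb{C}$ put $$(f\,d\sigma)^\vee(m)=\frac1{|S_r|}\sum_{x\in S_r}\chi(m\cdot x)f(x)\quad (m\in\mathbb{F}_q^{d-1}).$$ For every $C>0$ and every $c>0$ there is a constant $c'>0$, depending only on $C$ and $c$, such that the following holds. Let $d\equiv 3\pmod 4$, let $q\equiv 3\pmod 4$ be a prime power, let $\chi$ be a nontrivial additive character of $\mathbb{F}_q$, and assume that the extension estimate $$\Big(\sum_{m\in\mathbb{F}_q^{d-1}}|(f\,d\sigma)^\vee(m)|^{p}\Big)^{1/p}\le C\Big(\frac1{|S_r|}\sum_{x\in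 S_r}|f(x)|^2\Big)^{1/2},\qquad p=\frac{2d+2}{d-1},$$ holds for all $r\in\mathbb{F}_q\setminus\{0\}$ and all $f:S_r\to\mathbb{C}$. If $E\subset P_d$ satisfies $$|E|\ge c\,q^{\frac{(d-1)^2+2(d-1)}{2(d-1)+2}}=c\,q^{\frac d2-\frac1{2(d-1)+2}},$$ then $|\Pi(E)|\ge c'q$. -/

import Mathlib

open scoped BigOperators

namespace FiniteFieldExtension

/-- The paraboloid `x_d = x_1 ^ 2 + ⋯ + x_{d-1} ^ 2` in `F ^ d`; the index `i` with
`i + 1 = d` is the last coordinate. -/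
def paraboloid (F : Type*) [Field F] [Fintype F] [DecidableEq F] (d : ℕ) :
    Finset (Fin d → F) :=
  Finset.univ.filter fun x =>
    ∀ i : Fin d, (i : ℕ) + 1 = d → x i = ∑ j ∈ Finset.univ.erase i, x j ^ 2

/-- The sphere `x_1 ^ 2 + ⋯ + x_n ^ 2 = r` in `F ^ n`. -/
def sphere {F : Type*} [Field F] [Fintype F] [DecidableEq F] (n : ℕ) (r : F) :
    Finset (Fin n → F) :=
  Finset.univ.filter fun x => ∑ i, x i ^ 2 = r

/-- The set of dot products `x · y` with `x, y ∈ E`. -/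
def dotProductSet {F : Type*} [Field F] [DecidableEq F] {d : ℕ}
    (E : Finset (Fin d → F)) : Finset F :=
  (E ×ˢ E).image fun p => dotProduct p.1 p.2

/-- The inverse Fourier transform `(f dσ)^∨` of `f` times the normalized surface measure
on `V`: `c ↦ |V|⁻¹ ∑_{x ∈ V} χ(c · x) f(x)`. -/
noncomputable def extensionOp {F : Type*} [Field F] {n : ℕ}
    (χ : AddChar F ℂ) (V : Finset (Fin n → F)) (f : (Fin n → F) → ℂ) (c : Fin n → F) : ℂ :=
  (V.card : ℂ)⁻¹ * ∑ x ∈ V, χ (dotProduct c x) * f x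

/-- The norm of `g` in `L ^ p` for the counting measure on `F ^ n`. -/
noncomputable def countingNorm {F : Type*} [Fintype F] {n : ℕ}
    (p : ℝ) (g : (Fin n → F) → ℂ) : ℝ :=
  (∑ c, ‖g c‖ ^ p) ^ (1 / p)

/-- The norm of `f` in `L ^ p (V, dσ)`, where `dσ` is the normalized surface measure on `V`. -/
noncomputable def surfaceNorm {F : Type*} {n : ℕ}
    (p : ℝ) (V : Finset (Fin n → F)) (f : (Fin n → F) → ℂ) : ℝ :=
  ((V.card : ℝ)⁻¹ * ∑ x ∈ V, ‖f x‖ ^ p) ^ (1 / p)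

/-- The `L ^ p → L ^ s` extension estimate for `V` with constant `C`. -/
def ExtensionEstimate {F : Type*} [Field F] [Fintype F] {n : ℕ}
    (χ : AddChar F ℂ) (V : Finset (Fin n → F)) (p s C : ℝ) : Prop :=
  ∀ f : (Fin n → F) → ℂ, countingNorm s (extensionOp χ V f) ≤ C * surfaceNorm p V f

end FiniteFieldExtension

namespace FiniteFieldExtension

open Finset

/-! Put n = d - 1, so n ≡ 2 (mod 4), and project the paraboloid to its first n coordinates. The dot
product of two lifted points becomes x·y + |x|²|y|². If |y|² ≠ 0 and y' = -y/(2|y|²), then |x - y'|²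
= (x·y + |x|²|y|² + 1/4)/|y|², so Π(E) has at least as many elements as the set of distances from E
to the pin y'. At least half of E is either non-isotropic or isotropic.

Non-isotropic half: let A be the set of inverted points and ν_y(t) the number of x in E at distance
t from y. Gauss sums and Plancherel express the second moment of ν_y through the pieces S_ρ of the
Fourier expansion of 1_E on spheres of radius ρ. On the spheres with ρ ≠ 0, the extension estimate
and Hölder on A bound the pieces. No estimate is assumed for ρ = 0, but there S_0 is explicit in
ν_y(0) and cancels the t = 0 part of the moment (`sum_sq_distCount_le`). On average over A at most
half of E is at distance 0, so Cauchy–Schwarz over nonzero distances finishes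
(`card_le_of_pinned_distances`).

Isotropic half: the lifted product is x·y. The multiples sy stay on the zero sphere, where the L²
mass of the Fourier transform is small because the n-dimensional Gauss sum is negative
(`card_le_of_isotropic`). -/

/-- A matrix with orthogonal columns of constant norm acts as a multiple of an isometry. -/
lemma sum_norm_sq_of_orthogonal {S T : Type*} [Fintype S] [Fintype T] [DecidableEq T]
    (k : S → T → ℂ) (N : ℝ)
    (hk : ∀ t t', ∑ s, k s t * (starRingEnd ℂ) (k s t') = if t = t' then (N : ℂ) else 0)
    (f : T → ℂ) : ∑ s, ‖∑ t, k s t * f t‖ ^ 2 = N * ∑ t, ‖f t‖ ^ 2 := by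
  have h : ∀ z : ℂ, ((‖z‖ ^ 2 : ℝ) : ℂ) = z * (starRingEnd ℂ) z := fun z => by
    rw [Complex.mul_conj, Complex.normSq_eq_norm_sq]
  apply Complex.ofReal_injective
  push_cast
  simp only [← Complex.ofReal_pow, h, map_sum, map_mul, sum_mul_sum]
  rw [sum_comm]
  calc ∑ t, ∑ s, ∑ t', k s t * f t * ((starRingEnd ℂ) (k s t') * (starRingEnd ℂ) (f t'))
      = ∑ t, ∑ t', (f t * (starRingEnd ℂ) (f t')) *
          ∑ s, k s t * (starRingEnd ℂ) (k s t') := by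
        refine sum_congr rfl fun t _ => ?_
        rw [sum_comm]
        refine sum_congr rfl fun t' _ => ?_
        rw [mul_sum]
        exact sum_congr rfl fun s _ => by ring
    _ = _ := by
        rw [mul_sum]
        refine sum_congr rfl fun t _ => ?_
        simp [hk]
        ring

lemma sum_pi_prod {κ : Type*} [Fintype κ] {n : ℕ} (f : Fin n → κ → ℂ) :
    ∑ x : Fin n → κ, ∏ i, f i (x i) = ∏ i, ∑ t, f i t :=
  (Fintype.prod_sum f).symm

lemma addChar_sum {A ι : Type*} [AddCommMonoid A] (χ : AddChar A ℂ) (s : Finset ι) (f : ι → A) :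
    χ (∑ i ∈ s, f i) = ∏ i ∈ s, χ (f i) := by
  classical
  induction s using Finset.induction_on with
  | empty => simp
  | insert a s ha ih => rw [sum_insert ha, prod_insert ha, AddChar.map_add_eq_mul, ih]

/-! ### Character orthogonality and Gauss sums -/

section Characters

variable {F : Type*} [Field F] {n : ℕ} {χ : AddChar F ℂ}

/-- The quadratic form `x_1 ^ 2 + ⋯ + x_n ^ 2`. -/
def sqNorm (x : Fin n → F) : F := ∑ i, x i ^ 2

lemma sqNorm_neg (x : Fin n → F) : sqNorm (-x) = sqNorm x := by
  simp [sqNorm]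

variable [Fintype F]

lemma two_ne_zero_of_card (hq : Fintype.card F % 4 = 3) : (2 : F) ≠ 0 := by
  apply Ring.two_ne_zero
  intro h
  have := FiniteField.even_card_iff_char_two.1 h
  omega

/-- Completing the square: shift t by v/(2s). -/
lemma sum_addChar_quadratic_one (h2 : (2 : F) ≠ 0) {s : F} (hs : s ≠ 0) (v : F) :
    ∑ t, χ (s * t ^ 2 + v * t) = χ (-(4 * s)⁻¹ * v ^ 2) * ∑ t, χ (s * t ^ 2) := by
  rw [← Equiv.sum_comp (Equiv.addRight (-(v / (2 * s)))), mul_sum]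
  refine sum_congr rfl fun t _ => ?_
  rw [← AddChar.map_add_eq_mul]
  congr 1
  have h4 : (4 : F) ≠ 0 := by
    have : (4 : F) = 2 * 2 := by norm_num
    rw [this]; exact mul_ne_zero h2 h2
  simp only [Equiv.coe_addRight]
  field_simp
  ring

variable [DecidableEq F]

lemma sum_addChar_mul (hχ : χ ≠ 1) (b : F) :
    ∑ a, χ (a * b) = if b = 0 then (Fintype.card F : ℂ) else 0 := by
  have := AddChar.sum_mulShift b (AddChar.IsPrimitive.of_ne_one hχ)
  rw [this]; split_ifs <;> simp

lemma sum_addChar_dotProduct (hχ : χ ≠ 1) (z : Fin n → F) :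
    ∑ y : Fin n → F, χ (y ⬝ᵥ z) = if z = 0 then (Fintype.card F : ℂ) ^ n else 0 := by
  have : ∀ y : Fin n → F, χ (y ⬝ᵥ z) = ∏ i, χ (y i * z i) := fun y => by
    rw [dotProduct, addChar_sum]
  simp_rw [this]
  rw [sum_pi_prod (fun i t => χ (t * z i))]
  simp_rw [sum_addChar_mul hχ]
  split_ifs with h
  · subst h; simp
  · obtain ⟨i, hi⟩ := Function.ne_iff.1 h
    exact prod_eq_zero (mem_univ i) (by simpa using hi)

lemma sum_norm_sq_addChar_mul (hχ : χ ≠ 1) (f : F → ℂ) :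
    ∑ s, ‖∑ t, χ (s * t) * f t‖ ^ 2 = (Fintype.card F : ℝ) * ∑ t, ‖f t‖ ^ 2 := by
  refine sum_norm_sq_of_orthogonal _ _ (fun t t' => ?_) f
  simp_rw [← AddChar.map_neg_eq_conj, ← AddChar.map_add_eq_mul, ← mul_neg, ← mul_add,
    sum_addChar_mul hχ, ← sub_eq_add_neg, sub_eq_zero]
  simp

lemma sum_norm_sq_addChar_dotProduct (hχ : χ ≠ 1) (f : (Fin n → F) → ℂ) :
    ∑ y, ‖∑ m, χ (y ⬝ᵥ m) * f m‖ ^ 2 = (Fintype.card F : ℝ) ^ n * ∑ m, ‖f m‖ ^ 2 := by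
  refine sum_norm_sq_of_orthogonal _ _ (fun t t' => ?_) f
  simp_rw [← AddChar.map_neg_eq_conj, ← AddChar.map_add_eq_mul, ← dotProduct_neg,
    ← dotProduct_add, sum_addChar_dotProduct hχ, ← sub_eq_add_neg, sub_eq_zero]
  simp

/-- The quadratic Gauss sum over a field in which `-1` is not a square. -/
lemma sum_addChar_mul_sq_sq (hq : Fintype.card F % 4 = 3) (hχ : χ ≠ 1) {s : F} (hs : s ≠ 0) :
    (∑ t, χ (s * t ^ 2)) ^ 2 = -(Fintype.card F : ℂ) := by
  have hF : ringChar F ≠ 2 := fun h => by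
    have := FiniteField.even_card_iff_char_two.1 h
    omega
  have hp : (AddChar.mulShift χ s).IsPrimitive :=
    AddChar.IsPrimitive.of_ne_one (AddChar.IsPrimitive.of_ne_one hχ hs)
  set η : MulChar F ℂ := (quadraticChar F).ringHomComp (Int.castRingHom ℂ) with hη
  have hinj : Function.Injective (Int.castRingHom ℂ) := Int.cast_injective
  have h1 : η ≠ 1 := (MulChar.ringHomComp_ne_one_iff hinj).2 (quadraticChar_ne_one hF)
  have h2 : η.IsQuadratic := (quadraticChar_isQuadratic F).comp _
  have key : ∑ t, χ (s * t ^ 2) = gaussSum η (AddChar.mulShift χ s) := by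
    -- Since a has 1 + η(a) square roots, grouping by t² gives the twisted Gauss sum plus a full
    -- character sum, which vanishes.
    have hc : ∀ a : F, ((univ.filter fun t : F => t ^ 2 = a).card : ℂ) = η a + 1 := fun a => by
      have := quadraticChar_card_sqrts hF a
      have e : ({x : F | x ^ 2 = a} : Set F).toFinset = univ.filter fun t : F => t ^ 2 = a := by
        ext; simp
      rw [e] at this
      simp only [hη, MulChar.ringHomComp_apply, eq_intCast]
      exact_mod_cast congrArg (Int.cast : ℤ → ℂ) this
    rw [← sum_fiberwise univ (fun t : F => t ^ 2)]
    have : ∀ a : F, ∑ t ∈ univ.filter (fun t : F => t ^ 2 = a), χ (s * t ^ 2)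
        = η a * χ (s * a) + χ (a * s) := fun a => by
      rw [sum_congr rfl (g := fun _ => χ (s * a))
        (fun t ht => by rw [(mem_filter.1 ht).2]), sum_const, nsmul_eq_mul, hc, mul_comm a s]
      ring
    simp_rw [this, sum_add_distrib, sum_addChar_mul hχ, if_neg hs, add_zero]
    simp [gaussSum, AddChar.mulShift_apply]
  have hneg : η (-1) = -1 := by
    have : ¬ IsSquare (-1 : F) := by
      rw [FiniteField.isSquare_neg_one_iff]; omega
    have := quadraticChar_neg_one_iff_not_isSquare.2 this
    simp [hη, MulChar.ringHomComp_apply, this]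
  rw [key, gaussSum_sq h1 h2 hp, hneg]
  ring

lemma mem_sphere {r : F} {x : Fin n → F} : x ∈ sphere n r ↔ sqNorm x = r := by
  simp [sphere, sqNorm]

/-- The Gauss sum of the form `x_1 ^ 2 + ⋯ + x_n ^ 2` with `n ≡ 2 (mod 4)`, over a field in which
`-1` is not a square. -/
lemma sum_addChar_quadratic (hn : n % 4 = 2) (hq : Fintype.card F % 4 = 3) (hχ : χ ≠ 1)
    {s : F} (hs : s ≠ 0) (v : Fin n → F) :
    ∑ x : Fin n → F, χ (s * sqNorm x + v ⬝ᵥ x)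
      = -(Fintype.card F : ℂ) ^ (n / 2) * χ (-(4 * s)⁻¹ * sqNorm v) := by
  have h : ∀ x : Fin n → F, χ (s * sqNorm x + v ⬝ᵥ x) = ∏ i, χ (s * x i ^ 2 + v i * x i) :=
    fun x => by
      rw [← addChar_sum, sqNorm, dotProduct, mul_sum, sum_add_distrib]
  simp_rw [h]
  rw [sum_pi_prod (fun i t => χ (s * t ^ 2 + v i * t))]
  simp_rw [sum_addChar_quadratic_one (two_ne_zero_of_card hq) hs]
  rw [prod_mul_distrib, ← addChar_sum, ← mul_sum, prod_const, card_univ,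
    Fintype.card_fin]
  have ho : Odd (n / 2) := Nat.odd_iff.2 (by omega)
  have hpow : (∑ t, χ (s * t ^ 2)) ^ n = -(Fintype.card F : ℂ) ^ (n / 2) := by
    calc (∑ t, χ (s * t ^ 2)) ^ n = (∑ t, χ (s * t ^ 2)) ^ (2 * (n / 2)) := by
          congr 1; omega
      _ = _ := by rw [pow_mul, sum_addChar_mul_sq_sq hq hχ hs, ho.neg_pow]
  rw [hpow, sqNorm]
  ring

end Characters

/-! ### Duality between distance counts and frequency spheres -/

section Distances

variable {F : Type*} [Field F] {n : ℕ}

/-- The exponential sum `∑_{x ∈ E} χ(-m · x)`. -/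
noncomputable def fourierSum (χ : AddChar F ℂ) (E : Finset (Fin n → F)) (m : Fin n → F) : ℂ :=
  ∑ x ∈ E, χ (-(m ⬝ᵥ x))

/-- The number of points of `E` at distance `t` from `y`. -/
def distCount [DecidableEq F] (E : Finset (Fin n → F)) (y : Fin n → F) (t : F) : ℕ :=
  (E.filter fun x => sqNorm (x - y) = t).card

variable [Fintype F] [DecidableEq F]

/-- The part of the Fourier expansion of the indicator function of `E` with frequencies on the
sphere of radius `ρ`. -/
noncomputable def sphereSum (χ : AddChar F ℂ) (E : Finset (Fin n → F)) (ρ : F)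
    (y : Fin n → F) : ℂ :=
  ∑ m ∈ sphere n ρ, χ (y ⬝ᵥ m) * fourierSum χ E m

variable {χ : AddChar F ℂ}

lemma sum_norm_sq_fourierSum (hχ : χ ≠ 1) (E : Finset (Fin n → F)) :
    ∑ m, ‖fourierSum χ E m‖ ^ 2 = (Fintype.card F : ℝ) ^ n * E.card := by
  have h := sum_norm_sq_addChar_dotProduct hχ (fun x => if x ∈ E then (1 : ℂ) else 0)
  rw [← Equiv.sum_comp (Equiv.neg (Fin n → F))] at h
  have e : ∀ x : Fin n → F, ‖if x ∈ E then (1 : ℂ) else 0‖ ^ 2 = if x ∈ E then (1 : ℝ) else 0 :=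
    fun x => by split_ifs <;> simp
  simp_rw [e] at h
  simpa [fourierSum] using h

lemma sum_addChar_mul_sphereSum (E : Finset (Fin n → F)) (u : F) (y : Fin n → F) :
    ∑ ρ, χ (u * ρ) * sphereSum χ E ρ y
      = ∑ m, χ (u * sqNorm m + y ⬝ᵥ m) * fourierSum χ E m := by
  rw [← sum_fiberwise univ (fun m : Fin n → F => sqNorm m)]
  refine sum_congr rfl fun ρ _ => ?_
  rw [sphereSum, mul_sum]
  refine sum_congr (by ext; simp [mem_sphere]) fun m hm => ?_
  rw [(mem_filter.1 hm).2, AddChar.map_add_eq_mul, mul_assoc]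

lemma sum_addChar_mul_distCount (E : Finset (Fin n → F)) (s : F) (y : Fin n → F) :
    ∑ t, χ (s * t) * (distCount E y t : ℂ) = ∑ x ∈ E, χ (s * sqNorm (x - y)) := by
  rw [← sum_fiberwise E (fun x => sqNorm (x - y))]
  refine sum_congr rfl fun t _ => ?_
  rw [sum_congr rfl (g := fun _ => χ (s * t)) (fun x hx => by rw [(mem_filter.1 hx).2]),
    sum_const, nsmul_eq_mul, distCount, mul_comm]

lemma sum_distCount (E : Finset (Fin n → F)) (y : Fin n → F) :
    ∑ t, distCount E y t = E.card :=
  (card_eq_sum_card_fiberwise (fun _ _ => mem_coe.2 (mem_univ _))).symm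

lemma sum_addChar_mul_sphereSum_eq (E : Finset (Fin n → F)) (u : F) (y : Fin n → F) :
    ∑ ρ, χ (u * ρ) * sphereSum χ E ρ y
      = ∑ x ∈ E, ∑ m : Fin n → F, χ (u * sqNorm m + (y - x) ⬝ᵥ m) := by
  rw [sum_addChar_mul_sphereSum, sum_comm]
  refine sum_congr rfl fun m _ => ?_
  rw [fourierSum, mul_sum]
  refine sum_congr rfl fun x _ => ?_
  rw [← AddChar.map_add_eq_mul, sub_dotProduct, dotProduct_comm m x]
  congr 1
  ring

/-- The Fourier transform of a Gaussian with parameter u is a Gaussian with parameter -1/(4u), so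
sphere sums and distance counts are exchanged by duality. -/
lemma sum_addChar_mul_sphereSum_of_ne_zero (hn : n % 4 = 2) (hq : Fintype.card F % 4 = 3)
    (hχ : χ ≠ 1) (E : Finset (Fin n → F)) {u : F} (hu : u ≠ 0) (y : Fin n → F) :
    ∑ ρ, χ (u * ρ) * sphereSum χ E ρ y
      = -(Fintype.card F : ℂ) ^ (n / 2) *
        ∑ t, χ (-(4 * u)⁻¹ * t) * (distCount E y t : ℂ) := by
  rw [sum_addChar_mul_sphereSum_eq, sum_addChar_mul_distCount, mul_sum]
  refine sum_congr rfl fun x _ => ?_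
  rw [sum_addChar_quadratic hn hq hχ hu, ← sqNorm_neg, neg_sub]

lemma sum_sphereSum (hχ : χ ≠ 1) (E : Finset (Fin n → F)) (y : Fin n → F) :
    ∑ ρ, sphereSum χ E ρ y = if y ∈ E then (Fintype.card F : ℂ) ^ n else 0 := by
  have h := sum_addChar_mul_sphereSum_eq (χ := χ) E 0 y
  simp only [zero_mul, AddChar.map_zero_eq_one, one_mul, zero_add] at h
  rw [h]
  simp_rw [dotProduct_comm (y - _), sum_addChar_dotProduct hχ, sub_eq_zero]
  simp

/-- The map u ↦ -(4u)⁻¹ is an involution of all of F, since 0⁻¹ = 0; it fixes 0, which accounts for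
the subtracted term. -/
lemma sum_inversion {M : Type*} [AddCommGroup M] (h2 : (2 : F) ≠ 0) (f : F → M) :
    ∑ u ∈ univ.erase 0, f (-(4 * u)⁻¹) = ∑ s, f s - f 0 := by
  have h4 : (4 : F) ≠ 0 := by
    have : (4 : F) = 2 * 2 := by norm_num
    rw [this]; exact mul_ne_zero h2 h2
  have hinv : Function.Involutive fun u : F => -(4 * u)⁻¹ := fun u => by
    simp only [mul_inv, inv_neg, mul_neg, neg_neg, inv_inv]
    field_simp
  have h := Equiv.sum_comp hinv.toPerm f
  rw [← h, ← sum_erase_add univ _ (mem_univ (0 : F))]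
  simp [Function.Involutive.toPerm]

lemma card_mul_sphereSum_zero (hn : n % 4 = 2) (hq : Fintype.card F % 4 = 3) (hχ : χ ≠ 1)
    (E : Finset (Fin n → F)) (y : Fin n → F) :
    (Fintype.card F : ℂ) * sphereSum χ E 0 y
      = (if y ∈ E then (Fintype.card F : ℂ) ^ n else 0)
        - (Fintype.card F : ℂ) ^ (n / 2) * (Fintype.card F * distCount E y 0 - E.card) := by
  have swap : ∀ f : F → ℂ, ∑ u, ∑ ρ, χ (u * ρ) * f ρ = Fintype.card F * f 0 := fun f => by
    rw [sum_comm]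
    simp_rw [← sum_mul, sum_addChar_mul hχ]
    simp
  -- Summing over all u isolates ρ = 0; after the inversion, summing over s isolates t = 0. Only the
  -- zero frequencies need separate treatment.
  rw [← swap (fun ρ => sphereSum χ E ρ y), ← sum_erase_add univ _ (mem_univ (0 : F)),
    sum_congr rfl (fun u hu =>
      sum_addChar_mul_sphereSum_of_ne_zero hn hq hχ E (ne_of_mem_erase hu) y),
    ← mul_sum, sum_inversion (two_ne_zero_of_card hq)
      (fun s => ∑ t, χ (s * t) * (distCount E y t : ℂ)), swap (fun t => (distCount E y t : ℂ))]
  simp only [zero_mul, AddChar.map_zero_eq_one, one_mul, sum_sphereSum hχ]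
  rw [← Nat.cast_sum, sum_distCount]
  ring

/-- Plancherel in u on one side and in s = -1/(4u) on the other; the first term comes from u = 0,
and |E|² removes s = 0. -/
lemma card_mul_sum_norm_sq_sphereSum (hn : n % 4 = 2) (hq : Fintype.card F % 4 = 3)
    (hχ : χ ≠ 1) (E : Finset (Fin n → F)) (y : Fin n → F) :
    (Fintype.card F : ℝ) * ∑ ρ, ‖sphereSum χ E ρ y‖ ^ 2
      = (if y ∈ E then (Fintype.card F : ℝ) ^ (2 * n) else 0)
        + (Fintype.card F : ℝ) ^ n *
          (Fintype.card F * ∑ t, (distCount E y t : ℝ) ^ 2 - (E.card : ℝ) ^ 2) := by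
  have hg : ((Fintype.card F : ℝ) ^ (n / 2)) ^ 2 = (Fintype.card F : ℝ) ^ n := by
    rw [← pow_mul]; congr 1; omega
  rw [← sum_norm_sq_addChar_mul hχ, ← sum_erase_add univ _ (mem_univ (0 : F)),
    sum_congr rfl (fun u hu => by
      rw [sum_addChar_mul_sphereSum_of_ne_zero hn hq hχ E (ne_of_mem_erase hu) y, norm_mul,
        mul_pow, norm_neg, norm_pow, Complex.norm_natCast, hg]),
    ← mul_sum, sum_inversion (two_ne_zero_of_card hq)
      (fun s => ‖∑ t, χ (s * t) * (distCount E y t : ℂ)‖ ^ 2), sum_norm_sq_addChar_mul hχ]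
  simp only [zero_mul, AddChar.map_zero_eq_one, one_mul, sum_sphereSum hχ]
  rw [← Nat.cast_sum, sum_distCount]
  simp only [Complex.norm_natCast]
  have : ‖if y ∈ E then (Fintype.card F : ℂ) ^ n else 0‖ ^ 2
      = if y ∈ E then (Fintype.card F : ℝ) ^ (2 * n) else 0 := by
    split_ifs
    · rw [norm_pow, Complex.norm_natCast, ← pow_mul, mul_comm]
    · simp
  rw [this]
  ring

end Distances

/-! ### The extension estimate as a local L² bound -/

section Norms

variable {F : Type*} [Fintype F] {n : ℕ}

lemma countingNorm_nonneg (p : ℝ) (g : (Fin n → F) → ℂ) : 0 ≤ countingNorm p g :=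
  Real.rpow_nonneg (sum_nonneg fun _ _ => Real.rpow_nonneg (norm_nonneg _) _) _

/-- Hölder on A with exponent p/2. -/
lemma sum_norm_sq_le_countingNorm {p : ℝ} (hp : 2 ≤ p) (g : (Fin n → F) → ℂ)
    (A : Finset (Fin n → F)) :
    ∑ y ∈ A, ‖g y‖ ^ 2 ≤ (A.card : ℝ) ^ (1 - 2 / p) * countingNorm p g ^ 2 := by
  have hp0 : 0 < p := by linarith
  have h := Real.rpow_sum_le_const_mul_sum_rpow_of_nonneg A (p := p / 2) (f := fun y => ‖g y‖ ^ 2)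
    (by linarith) (fun _ _ => by positivity)
  have hpow : ∀ y, (‖g y‖ ^ 2) ^ (p / 2) = ‖g y‖ ^ p := fun y => by
    rw [← Real.rpow_natCast, ← Real.rpow_mul (norm_nonneg _)]
    congr 1; push_cast; ring
  simp_rw [hpow] at h
  have h' : (∑ y ∈ A, ‖g y‖ ^ 2) ^ (p / 2) ≤ (A.card : ℝ) ^ (p / 2 - 1) * ∑ y, ‖g y‖ ^ p :=
    h.trans (mul_le_mul_of_nonneg_left (sum_le_sum_of_subset_of_nonneg (subset_univ _)
      fun _ _ _ => Real.rpow_nonneg (norm_nonneg _) _) (by positivity))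
  have hS : 0 ≤ ∑ y ∈ A, ‖g y‖ ^ 2 := sum_nonneg fun _ _ => by positivity
  have hT : 0 ≤ ∑ y, ‖g y‖ ^ p := sum_nonneg fun _ _ => Real.rpow_nonneg (norm_nonneg _) _
  have h'' := Real.rpow_le_rpow (Real.rpow_nonneg hS _) h' (show 0 ≤ 2 / p by positivity)
  rw [← Real.rpow_mul hS, Real.mul_rpow (by positivity) hT, ← Real.rpow_mul (by positivity)] at h''
  rw [show p / 2 * (2 / p) = 1 by field_simp, Real.rpow_one] at h''
  rw [show (p / 2 - 1) * (2 / p) = 1 - 2 / p by field_simp] at h''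
  rw [countingNorm, ← Real.rpow_natCast (_ ^ _) 2, ← Real.rpow_mul hT]
  rwa [show 1 / p * ((2 : ℕ) : ℝ) = 2 / p by push_cast; ring]

lemma ExtensionEstimate.sum_norm_sq_le [Field F] {χ : AddChar F ℂ} {V : Finset (Fin n → F)} {p C : ℝ}
    (h : ExtensionEstimate χ V 2 p C) (hp : 2 ≤ p) (f : (Fin n → F) → ℂ)
    (A : Finset (Fin n → F)) :
    ∑ y ∈ A, ‖∑ m ∈ V, χ (y ⬝ᵥ m) * f m‖ ^ 2
      ≤ (A.card : ℝ) ^ (1 - 2 / p) * (C ^ 2 * (V.card * ∑ m ∈ V, ‖f m‖ ^ 2)) := by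
  rcases V.eq_empty_or_nonempty with rfl | hV
  · simp
  have hV0 : (0 : ℝ) < V.card := by exact_mod_cast hV.card_pos
  have h1 := sum_norm_sq_le_countingNorm hp (extensionOp χ V f) A
  have h2 : countingNorm p (extensionOp χ V f) ^ 2 ≤ (C * surfaceNorm 2 V f) ^ 2 :=
    pow_le_pow_left₀ (countingNorm_nonneg _ _) (h f) 2
  have h3 : surfaceNorm 2 V f ^ 2 = (V.card : ℝ)⁻¹ * ∑ m ∈ V, ‖f m‖ ^ 2 := by
    rw [surfaceNorm, ← Real.sqrt_eq_rpow, Real.sq_sqrt]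
    · simp
    · exact mul_nonneg (by positivity) (sum_nonneg fun _ _ => by positivity)
  rw [mul_pow, h3] at h2
  have h4 : ∀ y, ‖∑ m ∈ V, χ (y ⬝ᵥ m) * f m‖ ^ 2
      = (V.card : ℝ) ^ 2 * ‖extensionOp χ V f y‖ ^ 2 := fun y => by
    rw [extensionOp, norm_mul, norm_inv, Complex.norm_natCast]
    field_simp
  simp_rw [h4]
  rw [← mul_sum]
  calc _ ≤ (V.card : ℝ) ^ 2 * ((A.card : ℝ) ^ (1 - 2 / p) *
        (C ^ 2 * ((V.card : ℝ)⁻¹ * ∑ m ∈ V, ‖f m‖ ^ 2))) := by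
        gcongr
        exact h1.trans (by gcongr)
    _ = _ := by field_simp

end Norms

/-! ### Second moments of the distance counts -/

section Estimates

variable {F : Type*} [Field F] [Fintype F] [DecidableEq F] {n : ℕ} {χ : AddChar F ℂ}

lemma one_le_card_field (F : Type*) [Field F] [Fintype F] : (1 : ℝ) ≤ Fintype.card F := by
  exact_mod_cast Fintype.card_pos

lemma norm_sphereSum_zero (hn : n % 4 = 2) (hq : Fintype.card F % 4 = 3) (hχ : χ ≠ 1)
    (E : Finset (Fin n → F)) (y : Fin n → F) :
    (Fintype.card F : ℝ) ^ 2 * ‖sphereSum χ E 0 y‖ ^ 2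
      = ((if y ∈ E then (Fintype.card F : ℝ) ^ n else 0)
        - (Fintype.card F : ℝ) ^ (n / 2) * (Fintype.card F * distCount E y 0 - E.card)) ^ 2 := by
  have h := congrArg (fun z => ‖z‖ ^ 2) (card_mul_sphereSum_zero hn hq hχ E y)
  simp only [norm_mul, Complex.norm_natCast, mul_pow] at h
  rw [h, ← sq_abs (_ - _ : ℝ), ← Real.norm_eq_abs, ← Complex.norm_real]
  push_cast
  split_ifs <;> simp

/-- The radius-zero piece is removed exactly rather than estimated: expanding |S_0|² produces
q²ν_y(0)², which cancels the t = 0 term of the second moment. -/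
lemma sum_sq_distCount_le (hn : n % 4 = 2) (hq : Fintype.card F % 4 = 3) (hχ : χ ≠ 1)
    (E : Finset (Fin n → F)) (y : Fin n → F) :
    (Fintype.card F : ℝ) ^ n *
        (Fintype.card F * ∑ t ∈ univ.erase 0, (distCount E y t : ℝ) ^ 2)
      ≤ (Fintype.card F : ℝ) ^ n *
          (2 * (E.card : ℝ) ^ 2 + 2 * (Fintype.card F : ℝ) ^ (n / 2) * E.card)
        + Fintype.card F * ∑ ρ ∈ univ.erase 0, ‖sphereSum χ E ρ y‖ ^ 2 := by
  have h1 := card_mul_sum_norm_sq_sphereSum hn hq hχ E y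
  have h2 := norm_sphereSum_zero hn hq hχ E y
  have hg : ((Fintype.card F : ℝ) ^ (n / 2)) ^ 2 = (Fintype.card F : ℝ) ^ n := by
    rw [← pow_mul]; congr 1; omega
  have hq1 := one_le_card_field F
  rw [← sum_erase_add univ _ (mem_univ (0 : F)),
    ← sum_erase_add univ (fun t => (distCount E y t : ℝ) ^ 2) (mem_univ (0 : F)),
    mul_comm 2 n, pow_mul] at h1
  have hg0 : 0 ≤ (Fintype.card F : ℝ) ^ (n / 2) := by positivity
  generalize (∑ ρ ∈ univ.erase 0, ‖sphereSum χ E ρ y‖ ^ 2) = SB at *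
  generalize (∑ t ∈ univ.erase 0, (distCount E y t : ℝ) ^ 2) = S at *
  have hν : (0 : ℝ) ≤ distCount E y 0 := by positivity
  have he : (0 : ℝ) ≤ E.card := by positivity
  generalize (distCount E y 0 : ℝ) = ν at *
  generalize (E.card : ℝ) = e at *
  generalize ‖sphereSum χ E 0 y‖ ^ 2 = B at *
  rw [← hg] at *
  generalize (Fintype.card F : ℝ) ^ (n / 2) = g at *
  generalize (Fintype.card F : ℝ) = q at *
  have hq0 : 0 < q := by linarith
  refine le_of_mul_le_mul_left ?_ hq0
  -- What survives the cancellation is either of favourable sign, like the cross terms in ν, or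
  -- loses only a factor q ≥ 1.
  have hqe : 0 ≤ (q - 1) * (g ^ 2 * e ^ 2) := mul_nonneg (by linarith) (by positivity)
  have hg3 : 0 ≤ g ^ 3 * (q * ν) := by positivity
  have hge : 0 ≤ g ^ 3 * e * (q - 1) := mul_nonneg (by positivity) (by linarith)
  have hνe : 0 ≤ g ^ 2 * (q * (ν * e)) := by positivity
  have hg4 : 0 ≤ g ^ 4 * (q - 1) := mul_nonneg (by positivity) (by linarith)
  have hge' : 0 ≤ g ^ 3 * e * q := by positivity
  split_ifs at h1 h2 <;> nlinarith

lemma sum_norm_sq_sphereSum_le (hχ : χ ≠ 1) (E : Finset (Fin n → F)) (ρ : F) :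
    ∑ y, ‖sphereSum χ E ρ y‖ ^ 2 ≤ (Fintype.card F : ℝ) ^ (2 * n) * E.card := by
  have h := sum_norm_sq_addChar_dotProduct hχ
    (fun m => if m ∈ sphere n ρ then fourierSum χ E m else 0)
  simp only [mul_ite, mul_zero, sum_ite_mem, univ_inter] at h
  have h' : ∑ y, ‖sphereSum χ E ρ y‖ ^ 2 = _ := h
  rw [h', two_mul, pow_add, mul_assoc, ← sum_norm_sq_fourierSum hχ]
  refine mul_le_mul_of_nonneg_left (sum_le_sum fun m _ => ?_) (by positivity)
  split_ifs <;> simp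

/-- The deviation of ν_y(0) from |E|/q is S_0 up to a multiple of 1_E, and Plancherel alone bounds
S_0 in L². -/
lemma sum_sq_distCount_zero_sub_le (hn : n % 4 = 2) (hq : Fintype.card F % 4 = 3) (hχ : χ ≠ 1)
    (E : Finset (Fin n → F)) :
    ∑ y, ((Fintype.card F : ℝ) * distCount E y 0 - E.card) ^ 2
      ≤ 4 * (Fintype.card F : ℝ) ^ (n + 2) * E.card := by
  set q : ℝ := ((Fintype.card F : ℕ) : ℝ) with hq_def
  have hq1 : 1 ≤ q := one_le_card_field F
  have hg : (q ^ (n / 2)) ^ 2 = q ^ n := by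
    rw [← pow_mul]; congr 1; omega
  have hpt : ∀ y, q ^ n * (q * distCount E y 0 - E.card) ^ 2
      ≤ 2 * (if y ∈ E then q ^ (2 * n) else 0) + 2 * q ^ 2 * ‖sphereSum χ E 0 y‖ ^ 2 := fun y => by
    have h := norm_sphereSum_zero hn hq hχ E y
    have hi : (if y ∈ E then q ^ (2 * n) else 0) = (if y ∈ E then q ^ n else 0) ^ 2 := by
      split_ifs <;> ring
    rw [hi, mul_assoc 2 (q ^ 2), h, ← hq_def]
    conv_lhs => rw [← hg, ← mul_pow]
    generalize (if y ∈ E then q ^ n else 0) = a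
    generalize q ^ (n / 2) * (q * distCount E y 0 - E.card) = b
    -- 2a² + 2(a - b)² - b² = (2a - b)².
    nlinarith [sq_nonneg (2 * a - b)]
  have hsum := sum_le_sum fun y (_ : y ∈ (univ : Finset (Fin n → F))) => hpt y
  rw [← mul_sum, sum_add_distrib, ← mul_sum, ← mul_sum, sum_ite_mem, univ_inter, sum_const,
    nsmul_eq_mul] at hsum
  have hB := sum_norm_sq_sphereSum_le hχ E 0
  rw [← hq_def] at hB
  have hqn : 0 < q ^ n := by positivity
  refine le_of_mul_le_mul_left ?_ hqn
  refine hsum.trans ?_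
  have h2 : q ^ (2 * n) * E.card ≤ q ^ 2 * (q ^ (2 * n) * E.card) :=
    le_mul_of_one_le_left (by positivity) (one_le_pow₀ hq1)
  calc _ ≤ 2 * (q ^ 2 * (q ^ (2 * n) * E.card)) + 2 * q ^ 2 * (q ^ (2 * n) * E.card) := by
        refine add_le_add ?_ (mul_le_mul_of_nonneg_left hB (by positivity))
        rw [mul_comm (E.card : ℝ)]
        exact mul_le_mul_of_nonneg_left h2 zero_le_two
    _ = _ := by ring

/-- Detecting |m|² = ρ by characters, s = 0 gives qⁿ and each other s at most q^(n/2); the total is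
at most 2qⁿ because n/2 + 1 ≤ n. -/
lemma card_sphere_le (hn : n % 4 = 2) (hq : Fintype.card F % 4 = 3) {χ : AddChar F ℂ}
    (hχ : χ ≠ 1) (ρ : F) :
    (Fintype.card F : ℝ) * (sphere n ρ).card ≤ 2 * (Fintype.card F : ℝ) ^ n := by
  have h : (Fintype.card F : ℂ) * (sphere n ρ).card
      = ∑ s, χ (-(s * ρ)) * ∑ m : Fin n → F, χ (s * sqNorm m) := by
    simp_rw [mul_sum, ← AddChar.map_add_eq_mul, ← mul_neg, ← mul_add]
    rw [sum_comm]
    simp_rw [sum_addChar_mul hχ, neg_add_eq_zero]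
    rw [← sum_filter, sum_const, nsmul_eq_mul, mul_comm]
    congr 3
    ext; simp [mem_sphere, eq_comm]
  have h' := congrArg norm h
  rw [norm_mul, Complex.norm_natCast, Complex.norm_natCast] at h'
  rw [h', ← sum_erase_add univ _ (mem_univ (0 : F))]
  refine (norm_add_le _ _).trans ?_
  have hq1 := one_le_card_field F
  have h0 : ‖χ (-(0 * ρ)) * ∑ m : Fin n → F, χ (0 * sqNorm m)‖ = (Fintype.card F : ℝ) ^ n := by
    simp
  have h1 : ∀ s ∈ univ.erase (0 : F), ‖χ (-(s * ρ)) * ∑ m : Fin n → F, χ (s * sqNorm m)‖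
      ≤ (Fintype.card F : ℝ) ^ (n / 2) := fun s hs => by
    have := sum_addChar_quadratic hn hq hχ (ne_of_mem_erase hs) (0 : Fin n → F)
    simp only [zero_dotProduct, add_zero] at this
    rw [this]
    simp [AddChar.norm_apply]
  have h2 : (Fintype.card F : ℝ) * (Fintype.card F : ℝ) ^ (n / 2) ≤ (Fintype.card F : ℝ) ^ n := by
    rw [← pow_succ']
    exact pow_le_pow_right₀ hq1 (by omega)
  have h3 : ((univ.erase (0 : F)).card : ℝ) ≤ Fintype.card F := by
    exact_mod_cast card_le_univ _
  have h4 := (norm_sum_le _ _).trans (sum_le_card_nsmul _ _ _ h1)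
  rw [nsmul_eq_mul] at h4
  have h5 := mul_le_mul_of_nonneg_right h3
    (show (0 : ℝ) ≤ (Fintype.card F : ℝ) ^ (n / 2) by positivity)
  rw [h0]
  linarith

/-- The spheres are disjoint, so the local L² bounds add up to one application of Plancherel. -/
lemma sum_sum_norm_sq_sphereSum_le (hn : n % 4 = 2) (hq : Fintype.card F % 4 = 3) (hχ : χ ≠ 1)
    {p C : ℝ} (hp : 2 ≤ p) (hext : ∀ r : F, r ≠ 0 → ExtensionEstimate χ (sphere n r) 2 p C)
    (E A : Finset (Fin n → F)) :
    Fintype.card F * ∑ y ∈ A, ∑ ρ ∈ univ.erase 0, ‖sphereSum χ E ρ y‖ ^ 2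
      ≤ (Fintype.card F : ℝ) ^ n *
        (2 * C ^ 2 * (Fintype.card F : ℝ) ^ n * E.card * (A.card : ℝ) ^ (1 - 2 / p)) := by
  set q : ℝ := ((Fintype.card F : ℕ) : ℝ) with hq_def
  have hq1 : 1 ≤ q := one_le_card_field F
  rw [sum_comm, mul_sum]
  have h1 : ∀ ρ ∈ univ.erase (0 : F), q * ∑ y ∈ A, ‖sphereSum χ E ρ y‖ ^ 2
      ≤ (A.card : ℝ) ^ (1 - 2 / p) * C ^ 2 * (2 * q ^ n) *
        ∑ m ∈ sphere n ρ, ‖fourierSum χ E m‖ ^ 2 := fun ρ hρ => by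
    have h := (hext ρ (ne_of_mem_erase hρ)).sum_norm_sq_le hp (fourierSum χ E) A
    have hc := card_sphere_le hn hq hχ ρ
    have hS : 0 ≤ ∑ m ∈ sphere n ρ, ‖fourierSum χ E m‖ ^ 2 := sum_nonneg fun _ _ => by positivity
    calc _ ≤ q * ((A.card : ℝ) ^ (1 - 2 / p) *
          (C ^ 2 * ((sphere n ρ).card * ∑ m ∈ sphere n ρ, ‖fourierSum χ E m‖ ^ 2))) := by
          gcongr; exact h
      _ = (A.card : ℝ) ^ (1 - 2 / p) * C ^ 2 * (q * (sphere n ρ).card) *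
          ∑ m ∈ sphere n ρ, ‖fourierSum χ E m‖ ^ 2 := by ring
      _ ≤ _ := by gcongr
  refine (sum_le_sum h1).trans ?_
  rw [← mul_sum]
  have h2 : ∑ ρ ∈ univ.erase (0 : F), ∑ m ∈ sphere n ρ, ‖fourierSum χ E m‖ ^ 2
      ≤ q ^ n * E.card := by
    rw [hq_def, ← sum_norm_sq_fourierSum hχ, ← sum_fiberwise univ (fun m : Fin n → F => sqNorm m)]
    refine (sum_le_sum_of_subset_of_nonneg (subset_univ _) fun _ _ _ =>
      sum_nonneg fun _ _ => by positivity).trans (le_of_eq ?_)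
    exact sum_congr rfl fun ρ _ => sum_congr (by ext; simp [mem_sphere]) fun _ _ => rfl
  calc _ ≤ (A.card : ℝ) ^ (1 - 2 / p) * C ^ 2 * (2 * q ^ n) * (q ^ n * E.card) := by gcongr
    _ = _ := by ring

end Estimates

lemma sq_sum_sum_le {α β : Type*} (A : Finset α) (T : α → Finset β) (ν : α → β → ℝ) (P : ℕ)
    (hT : ∀ a ∈ A, (T a).card ≤ P) :
    (∑ a ∈ A, ∑ t ∈ T a, ν a t) ^ 2 ≤ A.card * P * ∑ a ∈ A, ∑ t ∈ T a, ν a t ^ 2 := by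
  rw [sum_sigma' A T ν, sum_sigma' A T (fun a t => ν a t ^ 2)]
  refine sq_sum_le_card_mul_sum_sq.trans
    (mul_le_mul_of_nonneg_right ?_ (sum_nonneg fun _ _ => sq_nonneg _))
  rw [card_sigma]
  exact_mod_cast sum_le_card_nsmul A _ P hT

/-! ### Pinned distances and isotropic sets -/

section Estimates

variable {F : Type*} [Field F] [Fintype F] [DecidableEq F] {n : ℕ} {χ : AddChar F ℂ}

/-- If many points of `E` have nonzero distance to the pins in `A`, then some pin determines a
positive proportion of all distances. -/
theorem card_le_of_pinned_distances (hn : n % 4 = 2) (hq : Fintype.card F % 4 = 3) (hχ : χ ≠ 1)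
    {p C : ℝ} (hp : 2 ≤ p) (hext : ∀ r : F, r ≠ 0 → ExtensionEstimate χ (sphere n r) 2 p C)
    {E A : Finset (Fin n → F)} {P : ℕ}
    (hP : ∀ y ∈ A, (E.image fun x => sqNorm (x - y)).card ≤ P) {κ : ℝ}
    (hE : (Fintype.card F : ℝ) ^ (n / 2) ≤ κ * E.card)
    (hEA : (Fintype.card F : ℝ) ^ n * (A.card : ℝ) ^ (1 - 2 / p) ≤ κ * E.card * A.card)
    (hlarge : 64 * (Fintype.card F : ℝ) ^ n ≤ E.card * A.card)
    (hq4 : (4 : ℝ) ≤ Fintype.card F) :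
    (Fintype.card F : ℝ) ≤ 4 * (2 + 2 * κ + 2 * C ^ 2 * κ) * P := by
  set q : ℝ := ((Fintype.card F : ℕ) : ℝ) with hq_def
  have hq0 : 0 < q := by linarith
  set e : ℝ := (E.card : ℝ) with he
  set a : ℝ := (A.card : ℝ) with ha
  have hea : 0 < e * a := lt_of_lt_of_le (by positivity) hlarge
  have he0 : 0 < e := lt_of_le_of_ne (by positivity) fun h => by simp [← h] at hea
  have ha0 : 0 < a := lt_of_le_of_ne (by positivity) fun h => by simp [← h] at hea
  have henergy : q * ∑ y ∈ A, ∑ t ∈ univ.erase 0, (distCount E y t : ℝ) ^ 2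
      ≤ (2 + 2 * κ + 2 * C ^ 2 * κ) * (e ^ 2 * a) := by
    have hqn : 0 < q ^ n := by positivity
    have h1 := sum_le_sum fun y (_ : y ∈ A) => sum_sq_distCount_le hn hq hχ E y
    rw [sum_add_distrib, ← mul_sum, ← mul_sum, ← mul_sum, sum_const, nsmul_eq_mul] at h1
    have h2 := sum_sum_norm_sq_sphereSum_le hn hq hχ hp hext E A
    rw [mul_sum] at h2
    rw [← hq_def, ← he, ← ha] at h1 h2
    have h3 : q ^ n * (q * ∑ y ∈ A, ∑ t ∈ univ.erase 0, (distCount E y t : ℝ) ^ 2)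
        ≤ q ^ n * (a * (2 * e ^ 2 + 2 * q ^ (n / 2) * e)
          + 2 * C ^ 2 * q ^ n * e * a ^ (1 - 2 / p)) := by linarith
    refine (le_of_mul_le_mul_left h3 hqn).trans ?_
    have h4 : a * (2 * e ^ 2 + 2 * q ^ (n / 2) * e) ≤ a * (2 * e ^ 2 + 2 * (κ * e) * e) := by
      gcongr
    have h5 : 2 * C ^ 2 * e * (q ^ n * a ^ (1 - 2 / p)) ≤ 2 * C ^ 2 * e * (κ * e * a) := by
      gcongr
    linarith
  -- Cauchy–Schwarz gives a deviation of at most q|E||A|/4, as 64 = 4·16; the main term |E||A| is at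
  -- most another quarter because q ≥ 4.
  have hzero : ∑ y ∈ A, (distCount E y 0 : ℝ) ≤ e * a / 2 := by
    have h1 : (∑ y ∈ A, (q * distCount E y 0 - e)) ^ 2 ≤ (q * (e * a) / 4) ^ 2 := by
      calc _ ≤ a * ∑ y ∈ A, (q * distCount E y 0 - e) ^ 2 := sq_sum_le_card_mul_sum_sq
        _ ≤ a * (4 * q ^ (n + 2) * e) := by
          refine mul_le_mul_of_nonneg_left ?_ ha0.le
          exact (sum_le_sum_of_subset_of_nonneg (subset_univ _) fun _ _ _ => sq_nonneg _).trans
            (sum_sq_distCount_zero_sub_le hn hq hχ E)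
        _ = (64 * q ^ n) * (q ^ 2 * (e * a) / 16) := by ring
        _ ≤ (e * a) * (q ^ 2 * (e * a) / 16) := by gcongr
        _ = _ := by ring
    have h2 := (abs_le_of_sq_le_sq' h1 (by positivity)).2
    rw [sum_sub_distrib, ← mul_sum, sum_const, nsmul_eq_mul, ← ha] at h2
    refine le_of_mul_le_mul_left (a := q) ?_ hq0
    nlinarith
  have hcount : ∑ y ∈ A, ∑ t ∈ (E.image fun x => sqNorm (x - y)).erase 0, (distCount E y t : ℝ)
      = e * a - ∑ y ∈ A, (distCount E y 0 : ℝ) := by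
    have h : ∀ y, ∑ t ∈ (E.image fun x => sqNorm (x - y)).erase 0, (distCount E y t : ℝ)
        = e - distCount E y 0 := fun y => by
      rw [eq_sub_iff_add_eq, he, ← sum_distCount E y, Nat.cast_sum,
        ← sum_erase_add univ _ (mem_univ (0 : F))]
      congr 1
      refine sum_subset (erase_subset_erase _ (subset_univ _)) fun t ht ht' => ?_
      rw [distCount, Nat.cast_eq_zero, card_eq_zero, filter_eq_empty_iff]
      intro x hx hxt
      exact ht' (mem_erase.2 ⟨ne_of_mem_erase ht, mem_image.2 ⟨x, hx, hxt⟩⟩)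
    simp_rw [h]
    rw [sum_sub_distrib, sum_const, nsmul_eq_mul, mul_comm e]
  have hcs := sq_sum_sum_le A (fun y => (E.image fun x => sqNorm (x - y)).erase 0)
    (fun y t => (distCount E y t : ℝ)) P (fun y hy => (card_erase_le).trans (hP y hy))
  have hmono : ∑ y ∈ A, ∑ t ∈ (E.image fun x => sqNorm (x - y)).erase 0, (distCount E y t : ℝ) ^ 2
      ≤ ∑ y ∈ A, ∑ t ∈ univ.erase 0, (distCount E y t : ℝ) ^ 2 :=
    sum_le_sum fun y _ => sum_le_sum_of_subset_of_nonneg (erase_subset_erase _ (subset_univ _))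
      fun _ _ _ => sq_nonneg _
  rw [hcount, ← ha] at hcs
  have hP0 : (0 : ℝ) ≤ P := Nat.cast_nonneg _
  have hlow : (e * a / 2) ^ 2 ≤ (e * a - ∑ y ∈ A, (distCount E y 0 : ℝ)) ^ 2 :=
    pow_le_pow_left₀ (by positivity) (by linarith) 2
  have hfinal : (e * a) ^ 2 * q ≤ (e * a) ^ 2 * (4 * (2 + 2 * κ + 2 * C ^ 2 * κ) * P) := by
    calc (e * a) ^ 2 * q = 4 * (e * a / 2) ^ 2 * q := by ring
      _ ≤ 4 * (a * P * ∑ y ∈ A, ∑ t ∈ univ.erase 0, (distCount E y t : ℝ) ^ 2) * q := by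
        gcongr
        exact hlow.trans (hcs.trans (by gcongr))
      _ = 4 * a * P * (q * ∑ y ∈ A, ∑ t ∈ univ.erase 0, (distCount E y t : ℝ) ^ 2) := by ring
      _ ≤ 4 * a * P * ((2 + 2 * κ + 2 * C ^ 2 * κ) * (e ^ 2 * a)) := by gcongr
      _ = _ := by ring
  exact le_of_mul_le_mul_left hfinal (by positivity)

/-- The left side is q times the sum of S_0 over E. The minus sign of the Gauss sum makes the ν_y(0)
terms negative, so they can be dropped. -/
lemma sum_sphere_zero_norm_sq_fourierSum_le (hn : n % 4 = 2) (hq : Fintype.card F % 4 = 3)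
    (hχ : χ ≠ 1) (E : Finset (Fin n → F)) :
    (Fintype.card F : ℝ) * ∑ m ∈ sphere n (0 : F), ‖fourierSum χ E m‖ ^ 2
      ≤ (Fintype.card F : ℝ) ^ n * E.card + (Fintype.card F : ℝ) ^ (n / 2) * (E.card : ℝ) ^ 2 := by
  have h : ((∑ m ∈ sphere n (0 : F), ‖fourierSum χ E m‖ ^ 2 : ℝ) : ℂ)
      = ∑ y ∈ E, sphereSum χ E 0 y := by
    simp only [sphereSum]
    rw [sum_comm, Complex.ofReal_sum]
    refine sum_congr rfl fun m _ => ?_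
    rw [← Complex.normSq_eq_norm_sq, Complex.normSq_eq_conj_mul_self, ← sum_mul]
    congr 1
    rw [fourierSum, map_sum]
    refine sum_congr rfl fun y _ => ?_
    rw [← AddChar.map_neg_eq_conj, neg_neg, dotProduct_comm]
  have h2 : (Fintype.card F : ℝ) * ∑ m ∈ sphere n (0 : F), ‖fourierSum χ E m‖ ^ 2
      = ∑ y ∈ E, ((Fintype.card F : ℝ) ^ n
        - (Fintype.card F : ℝ) ^ (n / 2) * (Fintype.card F * distCount E y 0 - E.card)) := by
    apply Complex.ofReal_injective
    rw [Complex.ofReal_mul, h, mul_sum, Complex.ofReal_sum]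
    refine sum_congr rfl fun y hy => ?_
    rw [Complex.ofReal_natCast, card_mul_sphereSum_zero hn hq hχ, if_pos hy]
    push_cast
    rfl
  rw [h2]
  have h3 : ∀ y ∈ E, ((Fintype.card F : ℝ) ^ n
        - (Fintype.card F : ℝ) ^ (n / 2) * (Fintype.card F * distCount E y 0 - E.card))
      ≤ (Fintype.card F : ℝ) ^ n + (Fintype.card F : ℝ) ^ (n / 2) * E.card := fun y _ => by
    have : 0 ≤ (Fintype.card F : ℝ) ^ (n / 2) * (Fintype.card F * distCount E y 0) := by positivity
    linarith
  refine (sum_le_card_nsmul _ _ _ h3).trans (le_of_eq ?_)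
  rw [nsmul_eq_mul]
  ring

/-- A set of isotropic vectors determines a positive proportion of all dot products. -/
theorem card_le_of_isotropic (hn : n % 4 = 2) (hq : Fintype.card F % 4 = 3) (hχ : χ ≠ 1)
    {E : Finset (Fin n → F)} (hE0 : E ⊆ sphere n 0) (hne : E.Nonempty) {κ : ℝ}
    (hE : (Fintype.card F : ℝ) ^ (n / 2) ≤ κ * E.card) {P : ℕ}
    (hP : ∀ y ∈ E, (E.image fun x => y ⬝ᵥ x).card ≤ P) :
    (Fintype.card F : ℝ) ≤ (1 + κ + κ ^ 2) * P := by
  have hsq := sum_sphere_zero_norm_sq_fourierSum_le hn hq hχ E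
  have hg : ((Fintype.card F : ℝ) ^ (n / 2)) ^ 2 = (Fintype.card F : ℝ) ^ n := by
    rw [← pow_mul]; congr 1; omega
  rw [← hg] at hsq
  have he0 : (0 : ℝ) < E.card := by exact_mod_cast hne.card_pos
  have hq1 := one_le_card_field F
  set μ : (Fin n → F) → F → ℕ := fun y t => (E.filter fun x => y ⬝ᵥ x = t).card with hμ
  have hsum : ∀ y, ∀ s : F, ∑ t, χ (s * t) * (μ y t : ℂ) = fourierSum χ E (-s • y) := fun y s => by
    rw [fourierSum, ← sum_fiberwise E (fun x => y ⬝ᵥ x)]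
    refine sum_congr rfl fun t _ => ?_
    rw [sum_congr rfl (g := fun _ => χ (s * t)) (fun x hx => by
      rw [← (mem_filter.1 hx).2, smul_dotProduct, smul_eq_mul, neg_mul, neg_neg]),
      sum_const, nsmul_eq_mul, mul_comm]
  -- The zero sphere is a cone, so scaling E by -s ≠ 0 permutes frequencies inside it.
  have hscale : ∀ s : F, s ≠ 0 → ∑ y ∈ E, ‖fourierSum χ E (-s • y)‖ ^ 2
      ≤ ∑ m ∈ sphere n (0 : F), ‖fourierSum χ E m‖ ^ 2 := fun s hs => by
    have hinj : Function.Injective fun y : Fin n → F => -s • y :=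
      smul_right_injective _ (neg_ne_zero.2 hs)
    rw [← sum_image (f := fun m => ‖fourierSum χ E m‖ ^ 2) hinj.injOn]
    refine sum_le_sum_of_subset_of_nonneg (fun m hm => ?_) fun _ _ _ => by positivity
    obtain ⟨y, hy, rfl⟩ := mem_image.1 hm
    have := mem_sphere.1 (hE0 hy)
    rw [mem_sphere, sqNorm]
    simp only [Pi.smul_apply, smul_eq_mul, mul_pow, ← mul_sum]
    rw [sqNorm] at this
    rw [this, mul_zero]
  have henergy : (Fintype.card F : ℝ) * ∑ y ∈ E, ∑ t, (μ y t : ℝ) ^ 2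
      ≤ (1 + κ + κ ^ 2) * (E.card : ℝ) ^ 3 := by
    have h1 : ∀ y, (Fintype.card F : ℝ) * ∑ t, (μ y t : ℝ) ^ 2
        = ∑ s : F, ‖fourierSum χ E (-s • y)‖ ^ 2 := fun y => by
      have := sum_norm_sq_addChar_mul hχ (fun t => (μ y t : ℂ))
      simp only [hsum, Complex.norm_natCast] at this
      exact this.symm
    rw [mul_sum, sum_congr rfl fun y _ => h1 y, sum_comm,
      ← sum_erase_add univ _ (mem_univ (0 : F))]
    have h2 := sum_le_card_nsmul (univ.erase (0 : F)) _ _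
      (fun s hs => hscale s (ne_of_mem_erase hs))
    rw [nsmul_eq_mul] at h2
    have h3 : ((univ.erase (0 : F)).card : ℝ) ≤ Fintype.card F := by
      exact_mod_cast card_le_univ _
    have h4 : 0 ≤ ∑ m ∈ sphere n (0 : F), ‖fourierSum χ E m‖ ^ 2 :=
      sum_nonneg fun _ _ => by positivity
    have h5 := mul_le_mul_of_nonneg_right h3 h4
    have h6 : ∑ y ∈ E, ‖fourierSum χ E (-(0 : F) • y)‖ ^ 2 = (E.card : ℝ) ^ 3 := by
      simp [fourierSum]; ring
    have h7 : ((Fintype.card F : ℝ) ^ (n / 2)) ^ 2 ≤ (κ * E.card) ^ 2 :=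
      pow_le_pow_left₀ (by positivity) hE 2
    have h8 := mul_le_mul_of_nonneg_right h7 he0.le
    have h9 := mul_le_mul_of_nonneg_right hE (sq_nonneg (E.card : ℝ))
    rw [h6]
    linarith
  have hcs := sq_sum_sum_le E (fun y => E.image fun x => y ⬝ᵥ x) (fun y t => (μ y t : ℝ)) P hP
  have hcount : ∀ y, ∑ t ∈ E.image (fun x => y ⬝ᵥ x), (μ y t : ℝ) = E.card := fun y => by
    rw [← Nat.cast_sum]
    exact congrArg _ (card_eq_sum_card_image _ _).symm
  have hmono : ∑ y ∈ E, ∑ t ∈ E.image (fun x => y ⬝ᵥ x), (μ y t : ℝ) ^ 2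
      ≤ ∑ y ∈ E, ∑ t, (μ y t : ℝ) ^ 2 :=
    sum_le_sum fun y _ => sum_le_sum_of_subset_of_nonneg (subset_univ _) fun _ _ _ => sq_nonneg _
  simp only [hcount, sum_const, nsmul_eq_mul] at hcs
  have hP0 : (0 : ℝ) ≤ P := Nat.cast_nonneg _
  have hfinal : (E.card : ℝ) ^ 4 * Fintype.card F
      ≤ (E.card : ℝ) ^ 4 * ((1 + κ + κ ^ 2) * P) := by
    calc (E.card : ℝ) ^ 4 * Fintype.card F = (E.card * E.card) ^ 2 * Fintype.card F := by ring
      _ ≤ (E.card * P * ∑ y ∈ E, ∑ t, (μ y t : ℝ) ^ 2) * Fintype.card F := by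
        gcongr
        exact hcs.trans (by gcongr)
      _ = E.card * P * (Fintype.card F * ∑ y ∈ E, ∑ t, (μ y t : ℝ) ^ 2) := by ring
      _ ≤ E.card * P * ((1 + κ + κ ^ 2) * (E.card : ℝ) ^ 3) := by gcongr
      _ = _ := by ring
  exact le_of_mul_le_mul_left hfinal (by positivity)

end Estimates

/-! ### From the paraboloid to distances -/

section Paraboloid

variable {F : Type*} [Field F] {n : ℕ} {χ : AddChar F ℂ}

lemma sqNorm_smul (a : F) (x : Fin n → F) : sqNorm (a • x) = a ^ 2 * sqNorm x := by
  simp [sqNorm, mul_pow, mul_sum]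

lemma sqNorm_sub (x y : Fin n → F) :
    sqNorm (x - y) = sqNorm x - 2 * (x ⬝ᵥ y) + sqNorm y := by
  simp only [sqNorm, dotProduct, Pi.sub_apply, mul_sum, ← sum_sub_distrib, ← sum_add_distrib]
  exact sum_congr rfl fun i _ => by ring

/-- The dot product of the lifts of `x` and `y` to the paraboloid. -/
def liftedDotProduct (x y : Fin n → F) : F := x ⬝ᵥ y + sqNorm x * sqNorm y

/-- The reflected inversion that turns lifted dot products into distances. -/
def inversion (y : Fin n → F) : Fin n → F := (-(2 * sqNorm y)⁻¹) • y

lemma sqNorm_sub_inversion (h2 : (2 : F) ≠ 0) (x : Fin n → F) {y : Fin n → F}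
    (hy : sqNorm y ≠ 0) :
    sqNorm (x - inversion y) = (liftedDotProduct x y + 4⁻¹) / sqNorm y := by
  have h4 : (4 : F) ≠ 0 := by
    have : (4 : F) = 2 * 2 := by norm_num
    rw [this]; exact mul_ne_zero h2 h2
  rw [sqNorm_sub, inversion, dotProduct_smul, sqNorm_smul, liftedDotProduct, smul_eq_mul]
  field_simp
  ring

/-- The image has square norm 1/(4|y|²), which determines |y|² and hence y. -/
lemma inversion_injOn (h2 : (2 : F) ≠ 0) :
    Set.InjOn (inversion (F := F) (n := n)) {y | sqNorm y ≠ 0} := by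
  have h4 : (4 : F) ≠ 0 := by
    have : (4 : F) = 2 * 2 := by norm_num
    rw [this]; exact mul_ne_zero h2 h2
  have hsq : ∀ y : Fin n → F, sqNorm y ≠ 0 → sqNorm (inversion y) = (4 * sqNorm y)⁻¹ :=
    fun y hy => by
      rw [inversion, sqNorm_smul]
      field_simp
      ring
  intro y hy z hz h
  have hyz : sqNorm y = sqNorm z := by
    have := congrArg sqNorm h
    rw [hsq y hy, hsq z hz, inv_inj] at this
    exact mul_left_cancel₀ h4 this
  simp only [inversion] at h
  rw [hyz] at h
  exact smul_right_injective _ (neg_ne_zero.2 (inv_ne_zero (mul_ne_zero h2 hz))) h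

variable [DecidableEq F]

/-- The set of dot products of the lifts to the paraboloid of the points of `E`. -/
def liftedDotProductSet (E : Finset (Fin n → F)) : Finset F :=
  (E ×ˢ E).image fun p => liftedDotProduct p.1 p.2

lemma card_image_sqNorm_sub_inversion_le (h2 : (2 : F) ≠ 0) (E : Finset (Fin n → F))
    {y : Fin n → F} (hy : y ∈ E) (hy0 : sqNorm y ≠ 0) :
    (E.image fun x => sqNorm (x - inversion y)).card ≤ (liftedDotProductSet E).card := by
  refine (card_le_card (t := (liftedDotProductSet E).image fun t => (t + 4⁻¹) / sqNorm y)
    fun t ht => ?_).trans card_image_le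
  obtain ⟨x, hx, rfl⟩ := mem_image.1 ht
  rw [sqNorm_sub_inversion h2 x hy0]
  exact mem_image_of_mem _ (mem_image.2 ⟨(x, y), mem_product.2 ⟨hx, hy⟩, rfl⟩)

lemma card_image_dotProduct_le (E : Finset (Fin n → F)) {y : Fin n → F} (hy : y ∈ E)
    (hy0 : sqNorm y = 0) :
    (E.image fun x => y ⬝ᵥ x).card ≤ (liftedDotProductSet E).card := by
  refine card_le_card fun t ht => ?_
  obtain ⟨x, hx, rfl⟩ := mem_image.1 ht
  exact mem_image.2 ⟨(y, x), mem_product.2 ⟨hy, hx⟩, by simp [liftedDotProduct, hy0]⟩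

lemma liftedDotProductSet_mono {E E' : Finset (Fin n → F)} (h : E ⊆ E') :
    liftedDotProductSet E ⊆ liftedDotProductSet E' :=
  image_subset_image (product_subset_product h h)

lemma pow_half_le_rpow (n : ℕ) {q : ℝ} (hq : 1 ≤ q) :
    q ^ (n / 2) ≤ q ^ (((n : ℝ) ^ 2 + 2 * n) / (2 * n + 2)) := by
  rw [← Real.rpow_natCast]
  refine Real.rpow_le_rpow_of_exponent_le hq ((Nat.cast_div_le (α := ℝ)).trans ?_)
  have hn : (0 : ℝ) ≤ n := Nat.cast_nonneg n
  push_cast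
  rw [div_le_div_iff₀ (by norm_num) (by positivity)]
  nlinarith

/-- Twice the critical exponent is n + n/(n+1) ≥ n + 1/2; the spare √q absorbs the constant 64. -/
lemma pow_mul_sqrt_le_rpow_sq {n : ℕ} (hn : 1 ≤ n) {q : ℝ} (hq : 1 ≤ q) :
    q ^ n * √q ≤ (q ^ (((n : ℝ) ^ 2 + 2 * n) / (2 * n + 2))) ^ 2 := by
  have hq0 : 0 < q := by linarith
  rw [Real.sqrt_eq_rpow, ← Real.rpow_natCast, ← Real.rpow_add hq0, ← Real.rpow_natCast,
    ← Real.rpow_mul hq0.le]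
  refine Real.rpow_le_rpow_of_exponent_le hq ?_
  have hn : (1 : ℝ) ≤ n := by exact_mod_cast hn
  rw [div_mul_eq_mul_div, le_div_iff₀ (by positivity)]
  push_cast
  nlinarith

/-- This is where the critical exponent is forced: X is defined by qⁿ = X^(1 + n/(n+2)), and 2/p =
n/(n+2). -/
lemma pow_mul_rpow_le {n : ℕ} (hn : 1 ≤ n) {q c e a : ℝ} (hq : 1 ≤ q) (hc : 0 < c) (hc1 : c ≤ 1)
    (he : c * q ^ (((n : ℝ) ^ 2 + 2 * n) / (2 * n + 2)) ≤ e)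
    (ha : c * q ^ (((n : ℝ) ^ 2 + 2 * n) / (2 * n + 2)) ≤ a) :
    q ^ n * a ^ (1 - 2 / ((2 * (n : ℝ) + 4) / n)) ≤ (c ^ 2)⁻¹ * e * a := by
  have hq0 : 0 < q := by linarith
  have hn : (1 : ℝ) ≤ n := by exact_mod_cast hn
  set X := q ^ (((n : ℝ) ^ 2 + 2 * n) / (2 * n + 2)) with hX
  have hX0 : 0 < X := by positivity
  have ha0 : 0 < a := lt_of_lt_of_le (by positivity) ha
  have hθ : 1 - 2 / ((2 * (n : ℝ) + 4) / n) = 1 - n / (n + 2) := by field_simp; ring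
  have hθ1 : (n : ℝ) / (n + 2) ≤ 1 := by rw [div_le_one (by positivity)]; linarith
  rw [hθ, Real.rpow_sub ha0, Real.rpow_one]
  have haθ : 0 < a ^ ((n : ℝ) / (n + 2)) := by positivity
  have hXX : q ^ n = X * X ^ ((n : ℝ) / (n + 2)) := by
    rw [hX, ← Real.rpow_mul hq0.le, ← Real.rpow_add hq0, ← Real.rpow_natCast]
    congr 1
    field_simp
    ring
  have h1 : c * X ^ ((n : ℝ) / (n + 2)) ≤ a ^ ((n : ℝ) / (n + 2)) := by
    calc c * X ^ ((n : ℝ) / (n + 2)) ≤ c ^ ((n : ℝ) / (n + 2)) * X ^ ((n : ℝ) / (n + 2)) := by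
          gcongr
          simpa using Real.rpow_le_rpow_of_exponent_ge hc hc1 hθ1
      _ = (c * X) ^ ((n : ℝ) / (n + 2)) := (Real.mul_rpow hc.le hX0.le).symm
      _ ≤ _ := by gcongr
  have h2 : c ^ 2 * q ^ n ≤ e * a ^ ((n : ℝ) / (n + 2)) := by
    rw [hXX]
    calc _ = (c * X) * (c * X ^ ((n : ℝ) / (n + 2))) := by ring
      _ ≤ _ := by gcongr; exact (mul_pos hc hX0).le.trans he
  rw [mul_div_assoc', div_le_iff₀ haθ, inv_mul_eq_div, div_mul_eq_mul_div, div_mul_eq_mul_div,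
    le_div_iff₀ (by positivity)]
  nlinarith

variable [Fintype F]

/-- A lower bound for the number of dot products of points on a paraboloid, in terms of the
projection of the point set. -/
theorem card_le_card_liftedDotProductSet (hn : n % 4 = 2) (hq : Fintype.card F % 4 = 3)
    (hχ : χ ≠ 1) {C : ℝ}
    (hext : ∀ r : F, r ≠ 0 →
      ExtensionEstimate χ (sphere n r) 2 ((2 * (n : ℝ) + 4) / n) C)
    {c : ℝ} (hc : 0 < c) (hc1 : c ≤ 1) {E : Finset (Fin n → F)}
    (hE : 2 * c * (Fintype.card F : ℝ) ^ (((n : ℝ) ^ 2 + 2 * n) / (2 * n + 2)) ≤ E.card) :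
    (Fintype.card F : ℝ) ≤ ((64 / c ^ 2) ^ 2 + 4 * (2 + 2 * (c ^ 2)⁻¹ + 2 * C ^ 2 * (c ^ 2)⁻¹)
      + (1 + (c ^ 2)⁻¹ + (c ^ 2)⁻¹ ^ 2)) * (liftedDotProductSet E).card := by
  set q : ℝ := ((Fintype.card F : ℕ) : ℝ) with hq_def
  have hq1 : 1 ≤ q := one_le_card_field F
  have hn1 : 1 ≤ n := by omega
  set X := q ^ (((n : ℝ) ^ 2 + 2 * n) / (2 * n + 2)) with hX
  have hX0 : 0 < X := by positivity
  have hκ : c⁻¹ ≤ (c ^ 2)⁻¹ := by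
    gcongr
    nlinarith
  have hhalf : q ^ (n / 2) ≤ X := pow_half_le_rpow n hq1
  have hκE : ∀ e : ℝ, c * X ≤ e → q ^ (n / 2) ≤ (c ^ 2)⁻¹ * e := fun e he => by
    calc q ^ (n / 2) ≤ X := hhalf
      _ = c⁻¹ * (c * X) := by field_simp
      _ ≤ _ := by gcongr
  have hne : E.Nonempty := by
    rw [← card_pos]
    exact_mod_cast lt_of_lt_of_le (by positivity : 0 < 2 * c * X) hE
  have hP1 : (1 : ℝ) ≤ (liftedDotProductSet E).card := by
    exact_mod_cast ((hne.product hne).image _).card_pos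
  set P : ℝ := ((liftedDotProductSet E).card : ℝ) with hP
  have hK1 : 0 ≤ (64 / c ^ 2) ^ 2 * P := by positivity
  have hK2 : 0 ≤ 4 * (2 + 2 * (c ^ 2)⁻¹ + 2 * C ^ 2 * (c ^ 2)⁻¹) * P := by positivity
  have hK3 : 0 ≤ (1 + (c ^ 2)⁻¹ + (c ^ 2)⁻¹ ^ 2) * P := by positivity
  rw [add_mul, add_mul]
  -- For bounded q, a single dot product suffices.
  rcases le_total q ((64 / c ^ 2) ^ 2) with hsmall | hbig
  · have := mul_le_mul hsmall hP1 zero_le_one (by positivity)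
    linarith
  have h64 : 64 ≤ c ^ 2 * √q := by
    have := Real.le_sqrt_of_sq_le hbig
    rwa [div_le_iff₀ (by positivity), mul_comm] at this
  have hq4 : 4 ≤ q := by
    have : 64 ≤ 64 / c ^ 2 := by
      rw [le_div_iff₀ (by positivity)]
      nlinarith
    nlinarith
  have hcard := card_filter_add_card_filter_not (s := E) (fun x => sqNorm x = 0)
  have hcard' : ((E.filter fun x => sqNorm x = 0).card : ℝ)
      + ((E.filter fun x => ¬ sqNorm x = 0).card : ℝ) = E.card := by exact_mod_cast hcard
  have h2 := two_ne_zero_of_card hq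
  rcases le_total (c * X) ((E.filter fun x => sqNorm x = 0).card : ℝ) with h0 | h0
  · have hne0 : (E.filter fun x => sqNorm x = 0).Nonempty := by
      rw [← card_pos]
      exact_mod_cast lt_of_lt_of_le (by positivity : 0 < c * X) h0
    have := card_le_of_isotropic hn hq hχ
      (fun x hx => mem_sphere.2 (mem_filter.1 hx).2) hne0 (hκE _ h0)
      (P := (liftedDotProductSet E).card) (fun y hy =>
        (card_image_dotProduct_le _ hy (mem_filter.1 hy).2).trans
          (card_le_card (liftedDotProductSet_mono (filter_subset _ _))))
    rw [← hq_def, ← hP] at this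
    linarith
  · set A := (E.filter fun x => ¬ sqNorm x = 0).image inversion with hA
    have hAcard : A.card = (E.filter fun x => ¬ sqNorm x = 0).card :=
      card_image_of_injOn fun y hy z hz h => inversion_injOn h2
        (mem_filter.1 (mem_coe.1 hy)).2 (mem_filter.1 (mem_coe.1 hz)).2 h
    have hA1 : c * X ≤ A.card := by rw [hAcard]; linarith
    have hE1 : c * X ≤ E.card := by nlinarith
    have hp : (2 : ℝ) ≤ (2 * (n : ℝ) + 4) / n := by
      have : (0 : ℝ) < n := by exact_mod_cast hn1
      rw [le_div_iff₀ this]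
      linarith
    have hlarge : 64 * q ^ n ≤ E.card * A.card := by
      calc 64 * q ^ n ≤ c ^ 2 * √q * q ^ n := by gcongr
        _ = c ^ 2 * (q ^ n * √q) := by ring
        _ ≤ c ^ 2 * X ^ 2 := by
          gcongr
          exact pow_mul_sqrt_le_rpow_sq hn1 hq1
        _ = (c * X) * (c * X) := by ring
        _ ≤ _ := by gcongr
    have := card_le_of_pinned_distances hn hq hχ hp hext (E := E) (A := A)
      (P := (liftedDotProductSet E).card) (fun y hy => by
        obtain ⟨z, hz, rfl⟩ := mem_image.1 hy
        exact card_image_sqNorm_sub_inversion_le h2 E (mem_filter.1 hz).1 (mem_filter.1 hz).2)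
      (hκE _ hE1) (pow_mul_rpow_le hn1 hq1 hc hc1 hE1 hA1) hlarge hq4
    rw [← hq_def, ← hP] at this
    linarith

lemma last_eq_sqNorm_init {x : Fin (n + 1) → F} (hx : x ∈ paraboloid F (n + 1)) :
    x (Fin.last n) = sqNorm (Fin.init x : Fin n → F) := by
  have h := (mem_filter.1 hx).2 (Fin.last n) (by simp)
  have h' := add_sum_erase univ (fun j => x j ^ 2) (mem_univ (Fin.last n))
  rw [Fin.sum_univ_castSucc, add_comm (x (Fin.last n) ^ 2)] at h'
  rw [h, add_right_cancel h']
  rfl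

lemma init_injOn_paraboloid :
    Set.InjOn (fun x : Fin (n + 1) → F => (Fin.init x : Fin n → F)) (paraboloid F (n + 1)) := by
  intro x hx y hy h
  rw [← Fin.snoc_init_self x, ← Fin.snoc_init_self y, last_eq_sqNorm_init hx,
    last_eq_sqNorm_init hy]
  simp only at h
  rw [h]

lemma liftedDotProductSet_image_init {E : Finset (Fin (n + 1) → F)}
    (hE : E ⊆ paraboloid F (n + 1)) :
    liftedDotProductSet (E.image fun x => (Fin.init x : Fin n → F)) = dotProductSet E := by
  rw [liftedDotProductSet, ← prodMap_image_product, image_image, dotProductSet]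
  refine image_congr fun p hp => ?_
  obtain ⟨h1, h2⟩ := mem_product.1 (mem_coe.1 hp)
  simp only [Function.comp, Prod.map, liftedDotProduct]
  rw [← last_eq_sqNorm_init (hE h1), ← last_eq_sqNorm_init (hE h2), dotProduct, dotProduct,
    Fin.sum_univ_castSucc]
  rfl

end Paraboloid

end FiniteFieldExtension

theorem theorem1p2 (C c : ℝ) (hc : 0 < c) :
    ∃ c' : ℝ, 0 < c' ∧
      ∀ (d : ℕ), d % 4 = 3 →
      ∀ (F : Type*) [Field F] [Fintype F] [DecidableEq F], Fintype.card F % 4 = 3 →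
      ∀ (χ : AddChar F ℂ), χ ≠ 1 →
      (∀ r : F, r ≠ 0 →
        FiniteFieldExtension.ExtensionEstimate χ
          (FiniteFieldExtension.sphere (d - 1) r) 2 ((2 * (d : ℝ) + 2) / ((d : ℝ) - 1)) C) →
      ∀ E : Finset (Fin d → F), E ⊆ FiniteFieldExtension.paraboloid F d →
      c * (Fintype.card F : ℝ) ^
          ((((d : ℝ) - 1) ^ 2 + 2 * ((d : ℝ) - 1)) / (2 * ((d : ℝ) - 1) + 2)) ≤ (E.card : ℝ) →
      c' * (Fintype.card F : ℝ) ≤ ((FiniteFieldExtension.dotProductSet E).card : ℝ) := by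
  -- Halving pays for the split into isotropic and non-isotropic points; the cap at 1 allows b ≤ b^θ
  -- for 0 ≤ θ ≤ 1.
  set b := min (c / 2) 1 with hb
  have hb0 : 0 < b := lt_min (by positivity) one_pos
  set K := (64 / b ^ 2) ^ 2 + 4 * (2 + 2 * (b ^ 2)⁻¹ + 2 * C ^ 2 * (b ^ 2)⁻¹)
      + (1 + (b ^ 2)⁻¹ + (b ^ 2)⁻¹ ^ 2) with hK
  have hK0 : 0 < K := by positivity
  refine ⟨K⁻¹, inv_pos.2 hK0, ?_⟩
  intro d hd F _ _ _ hq χ hχ hext E hE hcard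
  obtain ⟨n, rfl⟩ : ∃ n, d = n + 1 := ⟨d - 1, by omega⟩
  rw [inv_mul_le_iff₀ hK0, ← FiniteFieldExtension.liftedDotProductSet_image_init hE]
  have hd1 : ((n + 1 : ℕ) : ℝ) - 1 = n := by push_cast; ring
  refine FiniteFieldExtension.card_le_card_liftedDotProductSet (by omega) hq hχ
    (fun r hr => ?_) hb0 (min_le_right _ _) ?_
  · have := hext r hr
    rw [hd1, show 2 * ((n + 1 : ℕ) : ℝ) + 2 = 2 * (n : ℝ) + 4 by push_cast; ring] at this
    exact this
  · rw [Finset.card_image_of_injOn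
      (FiniteFieldExtension.init_injOn_paraboloid.mono (Finset.coe_subset.2 hE))]
    rw [hd1] at hcard
    refine le_trans (mul_le_mul_of_nonneg_right ?_ (by positivity)) hcard
    have := min_le_left (c / 2) 1
    linarith
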